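/- Let $M$ be a surface, that is, a Hausdorff $C^\infty$ manifold of dimension $2$ without boundary, and let $X$ be a $C^\infty$ vector field on $M$ with zero set $\mathsf Z(X)$. The order of $X$ at a point $p$ is the least integer $n \ge 0$ such that the $n$-jet of $X$ at $p$ is nonzero, and it is $\infty$ if the $\infty$-jet of $X$ at $p$ vanishes; $\mathsf Z_\infty(X)$ denotes the set of zeros of $X$ of order $\infty$ (the flat zeros). A $C^\infty$ vector field $Y$ on an open set $U \subset M$ tracks $X$ on $U$ if there is a continuous function $f\colon U \to \mathbb R$ with $[Y,X]=fX$ on $U$. A point $p \in \mathsf Z(X)$ is a primary singularity of $X$ if, for every open neighbourhood $U$ of $p$, every $C^\infty$ vector field on $U$ that tracks $X$ on $U$ vanishes at $p$. Suppose that $\mathsf Z(X) \neq \varnothing$ and $\mathsf Z_\infty(X) = \varnothing$. Then at least one of the following assertions holds: 1. $\mathsf Z(X)$ is a regular (embedded) $1$-dimensional $C^\infty$ submanifold of $M$. 2. There exists a primary singularity of $X$. -/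

import Mathlib

open scoped Manifold ContDiff

noncomputable section

namespace Tracking

variable {n : ℕ} {M : Type*} [TopologicalSpace M] [ChartedSpace (EuclideanSpace ℝ (Fin n)) M]

/-- The set `U` is meant to be open: `Y` is a smooth vector field on `U`. The values of `Y`
outside `U` are irrelevant. -/
def IsSmoothFieldOn [IsManifold (𝓡 n) ∞ M]
    (Y : (q : M) → TangentSpace (𝓡 n) q) (U : Set M) : Prop :=
  ContMDiffOn (𝓡 n) (𝓡 n).tangent ∞ (fun q : M => (⟨q, Y q⟩ : TangentBundle (𝓡 n) M)) U

/-- The zero set of a vector field. -/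
def zeros (X : (q : M) → TangentSpace (𝓡 n) q) : Set M :=
  {p | X p = 0}

/-- The vector field `X` written in the preferred coordinates about `p`. This is the same
expression as the one through which Mathlib defines the Lie bracket on a manifold. -/
def inCoordinates (X : (q : M) → TangentSpace (𝓡 n) q) (p : M) :
    EuclideanSpace ℝ (Fin n) → EuclideanSpace ℝ (Fin n) :=
  VectorField.mpullbackWithin 𝓘(ℝ, EuclideanSpace ℝ (Fin n)) (𝓡 n)
    (extChartAt (𝓡 n) p).symm X (Set.range (𝓡 n))

/-- The order of `X` at `p`: the least `k` for which the `k`-jet of `X` at `p` is nonzero, that is,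
the least `k` for which some partial derivative of order `k` of `X` in coordinates is nonzero
at `p`. It is `⊤` when the infinite jet of `X` at `p` vanishes. -/
def order (X : (q : M) → TangentSpace (𝓡 n) q) (p : M) : ℕ∞ :=
  sInf {k : ℕ∞ | ∃ m : ℕ, k = m ∧
    iteratedFDeriv ℝ m (inCoordinates X p) (extChartAt (𝓡 n) p p) ≠ 0}

/-- The set of zeros of order `k`; the flat zeros are those of order `⊤`. -/
def zerosOfOrder (X : (q : M) → TangentSpace (𝓡 n) q) (k : ℕ∞) : Set M :=
  {p | p ∈ zeros X ∧ order X p = k}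

/-- `Y` tracks `X` on `U`: there `[Y, X] = f X` for some continuous function `f`. -/
def TracksOn (Y X : (q : M) → TangentSpace (𝓡 n) q) (U : Set M) : Prop :=
  ∃ f : M → ℝ, ContinuousOn f U ∧
    ∀ q ∈ U, VectorField.mlieBracket (𝓡 n) Y X q = f q • X q

/-- A primary singularity of `X`: a zero `p` of `X` at which every smooth vector field vanishes
that is defined on an open neighbourhood of `p` and tracks `X` there. -/
def IsPrimarySingularity [IsManifold (𝓡 n) ∞ M]
    (X : (q : M) → TangentSpace (𝓡 n) q) (p : M) : Prop :=
  p ∈ zeros X ∧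
    ∀ (U : Set M) (Y : (q : M) → TangentSpace (𝓡 n) q), IsOpen U → p ∈ U →
      IsSmoothFieldOn Y U → TracksOn Y X U → Y p = 0

/-- A regular (embedded) submanifold of dimension `k`: about each of its points there is a
smooth chart of the ambient `n`-manifold in which `S` is the slice where the last `n - k`
coordinates vanish. -/
def IsRegularSubmanifold (n : ℕ) {M : Type*} [TopologicalSpace M]
    [ChartedSpace (EuclideanSpace ℝ (Fin n)) M] (k : ℕ) (S : Set M) : Prop :=
  k ≤ n ∧ ∀ p ∈ S, ∃ φ ∈ IsManifold.maximalAtlas (𝓡 n) ∞ M, p ∈ φ.source ∧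
    ∀ q ∈ φ.source, q ∈ S ↔ ∀ i : Fin n, k ≤ (i : ℕ) → φ q i = 0

end Tracking

end

/-!
The proof is local. Suppose that no zero of `X` is a primary singularity, and let `p` be a zero.
Then a field `Y` with `Y p ≠ 0` satisfies `[Y, X] = f X` near `p`. In coordinates this reads
`DX Y = DY X + f X`, so that along each integral curve of `Y` the field `X` solves a linear
differential equation. By Grönwall's inequality its norm varies there by a bounded factor only;
in particular, `X` vanishes either everywhere or nowhere on an integral curve.

Take coordinates `(s, y)` about `p` in which the integral curves are graphs over the `s`-axis, and
let `v` be the restriction of `X` to the transversal `s = 0`. If `v` vanished to infinite order,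
then so would `X`, since `‖X (s, y)‖` is comparable to `‖v‖` at a point whose distance from the
origin is `O(‖(s, y)‖)`; but `X` has no flat zeros. Hence `v` has an isolated zero, and the zeros
of `X` near `p` are exactly the points of the integral curve through `p`
(`exists_smooth_graph_of_norm_fderiv_le`). This curve is a smooth graph, which a shear straightens
(`exists_straightening_of_lieBracket_eq_smul`).

Only the integral curve through `p` has to be smooth. The flow of `Y` is never
differentiated with respect to initial values, and no smooth flow box is needed.
Infinite order is handled as the growth condition `IsFlatAt`; its relation to jets
(`isFlatAt_iteratedFDeriv`) rests on the fact that derivatives of flat functions are flat.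
-/

open Set Metric Filter Asymptotics Topology

/-! ### Flat functions -/

section Flat

variable {E F : Type*} [NormedAddCommGroup E] [NormedSpace ℝ E]
  [NormedAddCommGroup F] [NormedSpace ℝ F]

/-- A function vanishes to infinite order at `p` if it is `O(‖x - p‖ ^ k)` there for every `k`.
For smooth functions this is the vanishing of the infinite jet, but it is manifestly preserved by
bounds on the norm and by changes of coordinates. -/
def IsFlatAt (g : E → F) (p : E) : Prop :=
  ∀ k : ℕ, g =O[𝓝 p] fun x => ‖x - p‖ ^ k

omit [NormedSpace ℝ E] [NormedSpace ℝ F] in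
lemma IsFlatAt.eq_zero {g : E → F} {p : E} (h : IsFlatAt g p) : g p = 0 := by
  obtain ⟨C, hC⟩ := (h 1).bound
  simpa using hC.self_of_nhds

/-- The derivative of a flat function is flat. With `ρ = ‖x - p‖ ^ k`, the first order expansion of
`g` at `x` has an error `O(ρ ^ 2)` for increments of length `ρ`, and the values of `g` are
`O(ρ ^ 2)` as well; hence the derivative at `x` has norm `O(ρ)`. -/
lemma isFlatAt_fderiv {g : E → F} {p : E} (h : IsFlatAt g p) (hg : ContDiffAt ℝ 2 g p) :
    IsFlatAt (fderiv ℝ g) p := by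
  suffices H : ∀ k : ℕ, fderiv ℝ g =O[𝓝 p] fun x => ‖x - p‖ ^ (k + 1) by
    intro k
    refine (H k).trans (IsBigO.of_bound 1 ?_)
    filter_upwards [ball_mem_nhds p one_pos] with x hx
    rw [mem_ball, dist_eq_norm] at hx
    simp only [norm_pow, norm_norm, one_mul]
    exact pow_le_pow_of_le_one (norm_nonneg _) hx.le (Nat.le_succ k)
  intro k
  obtain ⟨L, s, hs, hL⟩ :=
    (hg.fderiv_right (m := 1) (by norm_num)).exists_lipschitzOnWith
  have hd : ∀ᶠ x in 𝓝 p, DifferentiableAt ℝ g x := by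
    have := hg.eventually (by simp)
    filter_upwards [this] with x hx using hx.differentiableAt (by simp)
  obtain ⟨C, hC0, hC⟩ := (h (2 * (k + 1))).exists_nonneg
  obtain ⟨r, hr, hball⟩ := Metric.mem_nhds_iff.1
    (Filter.inter_mem (Filter.inter_mem hs hd) hC.bound)
  have hp : fderiv ℝ g p = 0 := by
    have h2 : g =O[𝓝 p] fun x => ‖x - p‖ ^ 2 := h 2
    exact (h2.hasFDerivAt (by norm_num)).fderiv
  refine IsBigO.of_bound (C * 2 ^ (2 * (k + 1)) + C + L) ?_
  have hr' : 0 < min (r / 2) 1 := by positivity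
  filter_upwards [ball_mem_nhds p hr'] with x hx
  rw [mem_ball, dist_eq_norm, lt_min_iff] at hx
  rcases eq_or_ne x p with rfl | hxp
  · rw [hp, norm_zero]; positivity
  have hn : 0 < ‖x - p‖ := norm_pos_iff.2 (sub_ne_zero.2 hxp)
  set ρ : ℝ := ‖x - p‖ ^ (k + 1) with hρ
  have hρ0 : 0 < ρ := by positivity
  have hρ1 : ρ ≤ ‖x - p‖ := by
    simpa using pow_le_pow_of_le_one hn.le hx.2.le (Nat.le_add_left 1 k)
  rw [Real.norm_of_nonneg hρ0.le]
  refine ContinuousLinearMap.opNorm_le_of_unit_norm (by positivity) fun v hv => ?_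
  have hsub : closedBall x ρ ⊆ ball p r := fun y hy => by
    rw [mem_closedBall, dist_eq_norm] at hy
    rw [mem_ball, dist_eq_norm]
    linarith [norm_sub_le_norm_sub_add_norm_sub y x p]
  have hxs : x ∈ closedBall x ρ := mem_closedBall_self hρ0.le
  have hys : x + ρ • v ∈ closedBall x ρ := by
    simp [mem_closedBall, dist_eq_norm, norm_smul, hv, abs_of_pos hρ0]
  have hTaylor := Convex.norm_image_sub_le_of_norm_fderiv_le' (𝕜 := ℝ) (f := g)
    (φ := fderiv ℝ g x) (C := L * ρ) (fun y hy => (hball (hsub hy)).1.2)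
    (fun y hy => (hL.norm_sub_le (hball (hsub hy)).1.1 (hball (hsub hxs)).1.1).trans
      (by gcongr; simpa [dist_eq_norm] using hy)) (convex_closedBall x ρ) hxs hys
  have hx1 : ‖g x‖ ≤ C * ρ ^ 2 := by
    have := (hball (hsub hxs)).2
    rwa [mem_ofPred_eq, norm_pow, norm_norm, mul_comm 2, pow_mul] at this
  have hx2 : ‖g (x + ρ • v)‖ ≤ C * 2 ^ (2 * (k + 1)) * ρ ^ 2 := by
    have := (hball (hsub hys)).2
    rw [mem_ofPred_eq, norm_pow, norm_norm] at this
    refine this.trans ?_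
    rw [mul_assoc, hρ, ← pow_mul, mul_comm (k + 1), ← mul_pow]
    gcongr
    rw [mem_closedBall, dist_eq_norm] at hys
    linarith [norm_sub_le_norm_sub_add_norm_sub (x + ρ • v) x p]
  rw [add_sub_cancel_left, map_smul, norm_smul, hv, Real.norm_of_nonneg hρ0.le, mul_one] at hTaylor
  have hle : ρ * ‖fderiv ℝ g x v‖ ≤ ρ * ((C * 2 ^ (2 * (k + 1)) + C + L) * ρ) := by
    calc ρ * ‖fderiv ℝ g x v‖ = ‖ρ • fderiv ℝ g x v‖ := by
          rw [norm_smul, Real.norm_of_nonneg hρ0.le]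
      _ = ‖g (x + ρ • v) - g x - (g (x + ρ • v) - g x - ρ • fderiv ℝ g x v)‖ := by
          rw [sub_sub_cancel]
      _ ≤ ‖g (x + ρ • v)‖ + ‖g x‖ + L * ρ * ρ :=
          (norm_sub_le _ _).trans (add_le_add (norm_sub_le _ _) hTaylor)
      _ ≤ ρ * ((C * 2 ^ (2 * (k + 1)) + C + L) * ρ) := by nlinarith
  exact le_of_mul_le_mul_left hle hρ0

lemma isFlatAt_iteratedFDeriv {g : E → F} {p : E} (h : IsFlatAt g p) (hg : ContDiffAt ℝ ∞ g p)
    (m : ℕ) : IsFlatAt (iteratedFDeriv ℝ m g) p := by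
  induction m with
  | zero =>
    intro k
    refine IsBigO.of_norm_left ?_
    simpa using (h k).norm_left
  | succ m ih =>
    have := isFlatAt_fderiv ih
      (hg.iteratedFDeriv_right (m := 2) (i := m) (by norm_cast; exact ENat.LEInfty.out))
    intro k
    refine IsBigO.of_norm_left ?_
    simpa only [← norm_fderiv_iteratedFDeriv] using (this k).norm_left

/-- A smooth curve either is flat at `0` or does not vanish at the other points near `0`. -/
lemma isFlatAt_or_eventually_ne_zero {v : ℝ → F} {r : ℝ} (hr : 0 < r)
    (hv : ContDiffOn ℝ ∞ v (ball 0 r)) :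
    IsFlatAt v 0 ∨ ∀ᶠ s in 𝓝[≠] 0, v s ≠ 0 := by
  have hT (n : ℕ) : (fun s => v s - taylorWithinEval v n (ball 0 r) 0 s) =o[𝓝 0]
      fun s => s ^ n := by
    have := taylor_isLittleO (n := n) (convex_ball (0 : ℝ) r) (mem_ball_self hr)
      (hv.of_le ENat.LEInfty.out)
    simpa [isOpen_ball.nhdsWithin_eq (mem_ball_self hr)] using this
  by_cases H : ∀ n, iteratedDerivWithin n v (ball 0 r) 0 = 0
  · left
    intro k
    have := hT k
    simp only [taylor_within_apply, H, smul_zero, Finset.sum_const_zero, sub_zero] at this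
    simpa [norm_pow] using this.isBigO.norm_right
  · right
    push Not at H
    classical
    set n := Nat.find H
    have hn : iteratedDerivWithin n v (ball 0 r) 0 ≠ 0 := Nat.find_spec H
    have hlt : ∀ k < n, iteratedDerivWithin k v (ball 0 r) 0 = 0 := fun k hk => by
      simpa using Nat.find_min H hk
    have hT := hT n
    have hsum (s : ℝ) : taylorWithinEval v n (ball 0 r) 0 s =
        s ^ n • ((n.factorial : ℝ)⁻¹ • iteratedDerivWithin n v (ball 0 r) 0) := by
      rw [taylor_within_apply, Finset.sum_range_succ, Finset.sum_eq_zero, zero_add, sub_zero,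
        smul_smul, mul_comm]
      intro k hk
      rw [hlt k (Finset.mem_range.1 hk), smul_zero]
    set a := (n.factorial : ℝ)⁻¹ • iteratedDerivWithin n v (ball 0 r) 0
    have ha : a ≠ 0 := smul_ne_zero (by positivity) hn
    simp only [hsum] at hT
    have hb := hT.def (c := ‖a‖ / 2) (by positivity)
    filter_upwards [nhdsWithin_le_nhds hb, self_mem_nhdsWithin] with s hs hs0 hvs
    rw [hvs, zero_sub, norm_neg, norm_smul] at hs
    have : 0 < ‖s ^ n‖ := norm_pos_iff.2 (pow_ne_zero _ hs0)
    have : 0 < ‖a‖ := norm_pos_iff.2 ha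
    nlinarith

end Flat

/-! ### Linear differential inequalities and integral curves -/

/-- Grönwall's inequality in both time directions. -/
lemma norm_le_exp_mul_of_norm_deriv_le {F : Type*} [NormedAddCommGroup F] [NormedSpace ℝ F]
    {u u' : ℝ → F} {a b K : ℝ} (hu : ∀ t ∈ Icc a b, HasDerivWithinAt u (u' t) (Icc a b) t)
    (hK : ∀ t ∈ Icc a b, ‖u' t‖ ≤ K * ‖u t‖) {s t : ℝ} (hs : s ∈ Icc a b) (ht : t ∈ Icc a b) :
    ‖u t‖ ≤ Real.exp (K * |t - s|) * ‖u s‖ := by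
  have forward : ∀ {u u' : ℝ → F} {a b : ℝ},
      (∀ t ∈ Icc a b, HasDerivWithinAt u (u' t) (Icc a b) t) →
      (∀ t ∈ Icc a b, ‖u' t‖ ≤ K * ‖u t‖) → ∀ s ∈ Icc a b, ∀ t ∈ Icc a b, s ≤ t →
      ‖u t‖ ≤ Real.exp (K * |t - s|) * ‖u s‖ := by
    intro u u' a b hu hK s hs t ht hst
    have hsub : Icc s t ⊆ Icc a b := Icc_subset_Icc hs.1 ht.2
    have := norm_le_gronwallBound_of_norm_deriv_right_le (f := u) (f' := u') (δ := ‖u s‖) (K := K)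
      (ε := 0) (a := s) (b := t) (fun x hx => ((hu x (hsub hx)).continuousWithinAt).mono hsub)
      (fun x hx => ((hu x (hsub (Ico_subset_Icc_self hx))).mono hsub).mono_of_mem_nhdsWithin
        (Icc_mem_nhdsGE_of_mem hx)) le_rfl
      (fun x hx => by simpa using hK x (hsub (Ico_subset_Icc_self hx))) t ⟨hst, le_rfl⟩
    rwa [gronwallBound_ε0, mul_comm, ← abs_of_nonneg (sub_nonneg.2 hst)] at this
  rcases le_total s t with h | h
  · exact forward hu hK s hs t ht h
  · have hmaps : MapsTo (fun x : ℝ => -x) (Icc (-b) (-a)) (Icc a b) := fun x hx => by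
      constructor <;> linarith [hx.1, hx.2]
    have := forward (u := fun x => u (-x)) (u' := fun x => -u' (-x)) (a := -b) (b := -a)
      (fun x hx => by
        simpa [Function.comp_def] using
          (hu (-x) (hmaps hx)).scomp x (hasDerivAt_neg x).hasDerivWithinAt hmaps)
      (fun x hx => by simpa using hK (-x) (hmaps hx)) (-s) ⟨by linarith [hs.2], by linarith [hs.1]⟩
      (-t) ⟨by linarith [ht.2], by linarith [ht.1]⟩ (by linarith)
    simpa [abs_sub_comm, add_comm, ← sub_eq_add_neg, neg_add_eq_sub] using this

/-- The Picard-Lindelöf theorem, with the control of the range of the solution. -/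
lemma IsPicardLindelof.exists_hasDerivWithinAt_mem_closedBall {E : Type*} [NormedAddCommGroup E]
    [NormedSpace ℝ E] [CompleteSpace E] {f : ℝ → E → E} {tmin tmax : ℝ} {t₀ : Icc tmin tmax}
    {x₀ x : E} {a r L K : NNReal} (hf : IsPicardLindelof f t₀ x₀ a r L K)
    (hx : x ∈ closedBall x₀ r) :
    ∃ α : ℝ → E, α t₀ = x ∧ ∀ t ∈ Icc tmin tmax,
      HasDerivWithinAt α (f t (α t)) (Icc tmin tmax) t ∧ α t ∈ closedBall x₀ a := by
  obtain ⟨α, hα⟩ := ODE.FunSpace.exists_isFixedPt_next hf hx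
  refine ⟨α.compProj, by rw [ODE.FunSpace.compProj_val, ← hα, ODE.FunSpace.next_apply₀],
    fun t ht => ⟨?_, α.compProj_mem_closedBall hf.mul_max_le⟩⟩
  apply ODE.hasDerivWithinAt_picard_Icc t₀.2 hf.continuousOn_uncurry
    α.continuous_compProj.continuousOn (fun _ ht' ↦ α.compProj_mem_closedBall hf.mul_max_le)
    x ht |>.congr_of_mem _ ht
  intro t' ht'
  nth_rw 1 [← hα]
  rw [ODE.FunSpace.compProj_of_mem ht', ODE.FunSpace.next_apply]

/-! ### Zeros of a function that is transported linearly along a direction field -/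

/-- Let `(1, w)` be a smooth direction field near the origin of the plane, and let the derivative
of `g` along it be bounded by a multiple of `g`. If `g` vanishes at the origin, but is not flat
there, then the zero set of `g` near the origin is the graph of a smooth function, namely of the
integral curve through the origin: by Grönwall's inequality `‖g‖` varies at most by a bounded
factor along each integral curve, so both the zeros and the flatness of `g` are
determined by its restriction to the vertical axis, and this restriction has an isolated zero. -/
theorem exists_smooth_graph_of_norm_fderiv_le {F : Type*} [NormedAddCommGroup F] [NormedSpace ℝ F]
    {g : ℝ × ℝ → F} {w : ℝ × ℝ → ℝ} {Ω : Set (ℝ × ℝ)} {K : ℝ} (hΩ : IsOpen Ω) (h0 : 0 ∈ Ω)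
    (hg : ContDiffOn ℝ ∞ g Ω) (hw : ContDiffOn ℝ ∞ w Ω)
    (hK : ∀ x ∈ Ω, ‖fderiv ℝ g x (1, w x)‖ ≤ K * ‖g x‖) (hg0 : g 0 = 0) (hflat : ¬ IsFlatAt g 0) :
    ∃ r > 0, ∃ c : ℝ → ℝ, ContDiffOn ℝ ∞ c (Ioo (-r) r) ∧
      ∀ s ∈ Ioo (-r) r, ∀ y ∈ Ioo (-r) r, g (s, y) = 0 ↔ y = c s := by
  have hw0 : ContDiffAt ℝ 1 w 0 := (hw.contDiffAt (hΩ.mem_nhds h0)).of_le (by simp)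
  obtain ⟨Λ, S, hS, hΛ⟩ := hw0.exists_lipschitzOnWith
  have hwb : ∀ᶠ x in 𝓝 (0 : ℝ × ℝ), ‖w x‖ ≤ ‖w 0‖ + 1 :=
    hw0.continuousAt.norm.eventually_le_const (by linarith)
  obtain ⟨R', hR', hball⟩ := Metric.mem_nhds_iff.1
    (Filter.inter_mem (Filter.inter_mem (hΩ.mem_nhds h0) hS) hwb)
  obtain ⟨R, hR, hRR'⟩ := exists_between hR'
  set L : ℝ := ‖w 0‖ + 1 with hL
  have hL0 : 0 < L := by positivity
  -- The box on which everything takes place, and a time so short that no curve leaves it.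
  have hbox : ∀ t ∈ Icc (-R) R, ∀ y ∈ closedBall (0 : ℝ) R, (t, y) ∈ Ω ∩ S ∧ ‖w (t, y)‖ ≤ L := by
    intro t ht y hy
    refine hball (closedBall_subset_ball hRR' ?_)
    rw [mem_closedBall, Prod.dist_eq]
    exact max_le (by simpa [abs_le] using ht) hy
  obtain ⟨ε, hε, hεR, hεL⟩ : ∃ ε > 0, ε ≤ R ∧ L * (2 * ε) ≤ R / 2 :=
    ⟨min R (R / (4 * L)), by positivity, min_le_left _ _, by
      calc L * (2 * min R (R / (4 * L))) ≤ L * (2 * (R / (4 * L))) := by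
            gcongr; exact min_le_right _ _
        _ = R / 2 := by field_simp; norm_num⟩
  have hεsub : Icc (-ε) ε ⊆ Icc (-R) R := Icc_subset_Icc (by linarith) hεR
  -- Integral curves through the points of the inner box.
  have hcurve : ∀ s ∈ Icc (-ε) ε, ∀ y ∈ closedBall (0 : ℝ) (R / 2), ∃ c : ℝ → ℝ, c s = y ∧
      ∀ t ∈ Icc (-ε) ε, HasDerivWithinAt c (w (t, c t)) (Icc (-ε) ε) t ∧
        c t ∈ closedBall (0 : ℝ) R := by
    intro s hs y hy
    have hPL : IsPicardLindelof (fun t y => w (t, y)) (⟨s, hs⟩ : Icc (-ε) ε) 0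
        (⟨R, hR.le⟩ : NNReal) (⟨R / 2, by positivity⟩ : NNReal) (⟨L, hL0.le⟩ : NNReal) Λ := by
      refine ⟨fun t ht => ?_, fun y hy => ?_, fun t ht y hy => (hbox t (hεsub ht) y hy).2, ?_⟩
      · refine LipschitzOnWith.of_dist_le_mul fun y hy z hz => ?_
        simpa [Prod.dist_eq] using hΛ.dist_le_mul _ (hbox t (hεsub ht) y hy).1.2 _
          (hbox t (hεsub ht) z hz).1.2
      · exact hw.continuousOn.comp (by fun_prop) fun t ht => (hbox t (hεsub ht) y hy).1.1
      · change L * max (ε - s) (s - -ε) ≤ R - R / 2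
        have : max (ε - s) (s - -ε) ≤ 2 * ε := max_le (by linarith [hs.1]) (by linarith [hs.2])
        nlinarith
    exact hPL.exists_hasDerivWithinAt_mem_closedBall hy
  have hzero : (0 : ℝ) ∈ Icc (-ε) ε := ⟨by linarith, hε.le⟩
  -- Along such curves `‖g‖` varies by a bounded factor.
  have hgron : ∀ c : ℝ → ℝ, (∀ t ∈ Icc (-ε) ε, HasDerivWithinAt c (w (t, c t)) (Icc (-ε) ε) t ∧
      c t ∈ closedBall (0 : ℝ) R) → ∀ s ∈ Icc (-ε) ε, ∀ t ∈ Icc (-ε) ε,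
      ‖g (t, c t)‖ ≤ Real.exp (K * |t - s|) * ‖g (s, c s)‖ := by
    intro c hc s hs t ht
    refine norm_le_exp_mul_of_norm_deriv_le (u := fun t => g (t, c t))
      (u' := fun t => fderiv ℝ g (t, c t) (1, w (t, c t))) (fun t ht => ?_) (fun t ht => ?_) hs ht
    · have hmem := (hbox t (hεsub ht) _ (hc t ht).2).1.1
      have hd : HasFDerivAt g (fderiv ℝ g (t, c t)) (t, c t) :=
        ((hg.contDiffAt (hΩ.mem_nhds hmem)).differentiableAt (by simp)).hasFDerivAt
      exact hd.comp_hasDerivWithinAt t ((hasDerivWithinAt_id t _).prodMk (hc t ht).1)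
    · exact hK _ (hbox t (hεsub ht) _ (hc t ht).2).1.1
  have hdisp : ∀ c : ℝ → ℝ, (∀ t ∈ Icc (-ε) ε, HasDerivWithinAt c (w (t, c t)) (Icc (-ε) ε) t ∧
      c t ∈ closedBall (0 : ℝ) R) → ∀ s ∈ Icc (-ε) ε, |c 0| ≤ |c s| + L * |s| := by
    intro c hc s hs
    have := (convex_Icc (-ε) ε).norm_image_sub_le_of_norm_hasDerivWithin_le (C := L)
      (fun t ht => (hc t ht).1) (fun t ht => (hbox t (hεsub ht) _ (hc t ht).2).2) hs hzero
    rw [Real.norm_eq_abs, Real.norm_eq_abs, zero_sub, abs_neg] at this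
    linarith [abs_sub_abs_le_abs_sub (c 0) (c s)]
  -- The restriction of `g` to the vertical axis is not flat, since otherwise `g` would be.
  have hvs : ContDiffOn ℝ ∞ (fun y : ℝ => g (0, y)) (ball 0 R) :=
    hg.comp (by fun_prop) fun y hy =>
      (hbox 0 (hεsub hzero) y (ball_subset_closedBall hy)).1.1
  have hiso : ∀ᶠ y in 𝓝[≠] (0 : ℝ), g (0, y) ≠ 0 := by
    refine (isFlatAt_or_eventually_ne_zero hR hvs).resolve_left fun hv => hflat fun k => ?_
    obtain ⟨C, hC0, hC⟩ := (hv k).exists_nonneg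
    obtain ⟨η, hη, hCη⟩ := Metric.mem_nhds_iff.1 hC.bound
    refine IsBigO.of_bound (Real.exp (|K| * ε) * (C * (1 + L) ^ k)) ?_
    have hδ : 0 < min (min ε (R / 2)) (η / (1 + L)) := by positivity
    filter_upwards [ball_mem_nhds (0 : ℝ × ℝ) hδ] with x hx
    rw [mem_ball, dist_zero_right, lt_min_iff, lt_min_iff] at hx
    obtain ⟨⟨hx1, hx2⟩, hx3⟩ := hx
    rw [lt_div_iff₀ (by positivity)] at hx3
    have hxs : |x.1| ≤ ‖x‖ := norm_fst_le x
    have hxy : |x.2| ≤ ‖x‖ := norm_snd_le x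
    have hs : x.1 ∈ Icc (-ε) ε := abs_le.1 (hxs.trans hx1.le)
    obtain ⟨c, hcx, hc⟩ := hcurve x.1 hs x.2 (by simpa using hxy.trans hx2.le)
    have h1 := hgron c hc 0 hzero x.1 hs
    have h2 : |c 0| ≤ (1 + L) * ‖x‖ := by
      have := hdisp c hc x.1 hs
      rw [hcx] at this
      nlinarith
    have h3 : ‖g (0, c 0)‖ ≤ C * |c 0| ^ k := by
      have : c 0 ∈ ball (0 : ℝ) η := by
        rw [mem_ball, dist_zero_right, Real.norm_eq_abs]; linarith
      simpa using hCη this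
    rw [hcx] at h1
    calc ‖g x‖ ≤ Real.exp (K * |x.1 - 0|) * ‖g (0, c 0)‖ := h1
      _ ≤ Real.exp (|K| * ε) * (C * ((1 + L) * ‖x‖) ^ k) := by
          gcongr
          · exact le_abs_self K
          · rw [sub_zero]; exact hxs.trans hx1.le
          · exact h3.trans (by gcongr)
      _ = Real.exp (|K| * ε) * (C * (1 + L) ^ k) * ‖‖x - 0‖ ^ k‖ := by
          rw [sub_zero, norm_pow, norm_norm, mul_pow]; ring
  obtain ⟨η, hη, hiso⟩ := Metric.mem_nhdsWithin_iff.1 hiso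
  obtain ⟨c, hc0, hc⟩ := hcurve 0 hzero 0 (by simp; positivity)
  obtain ⟨r, hr, hrε, hrR, hrη⟩ : ∃ r > 0, r ≤ ε ∧ r ≤ R / 2 ∧ (1 + L) * r ≤ η :=
    ⟨min (min ε (R / 2)) (η / (1 + L)), by positivity, (min_le_left _ _).trans (min_le_left _ _),
      (min_le_left _ _).trans (min_le_right _ _), by
        rw [← le_div_iff₀' (by positivity)]; exact min_le_right _ _⟩
  have hrsub : Ioo (-r) r ⊆ Icc (-ε) ε :=
    Ioo_subset_Icc_self.trans (Icc_subset_Icc (by linarith) hrε)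
  refine ⟨r, hr, c, ?_, fun s hs y hy => ⟨fun h => ?_, fun h => ?_⟩⟩
  · have hwbox : ContDiffOn ℝ ∞ (Function.uncurry fun t y => w (t, y))
        (Icc (-ε) ε ×ˢ closedBall (0 : ℝ) R) :=
      hw.mono fun x hx => (hbox x.1 (hεsub hx.1) x.2 hx.2).1.1
    exact (ODE.contDiffOn_enat_Icc_of_hasDerivWithinAt (n := ⊤) hwbox (fun t ht => (hc t ht).1)
      fun t ht => (hc t ht).2).mono hrsub
  · have hs' := hrsub hs
    obtain ⟨b, hb0, hb⟩ := hcurve s hs' y (by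
      rw [mem_closedBall, dist_zero_right, Real.norm_eq_abs]
      exact (abs_lt.2 hy).le.trans hrR)
    have hgb : g (0, b 0) = 0 := by
      have := hgron b hb s hs' 0 hzero
      rw [hb0, h, norm_zero, mul_zero] at this
      exact norm_le_zero_iff.1 this
    have hbc : b 0 = 0 := by
      by_contra hne
      refine hiso ⟨?_, hne⟩ hgb
      have := hdisp b hb s hs'
      rw [hb0] at this
      rw [mem_ball, dist_zero_right, Real.norm_eq_abs]
      nlinarith [abs_lt.2 hs, abs_lt.2 hy]
    -- Two integral curves that meet on the vertical axis agree.
    have := norm_le_exp_mul_of_norm_deriv_le (u := fun t => b t - c t)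
      (u' := fun t => w (t, b t) - w (t, c t)) (K := Λ)
      (fun t ht => (hb t ht).1.sub (hc t ht).1) (fun t ht => by
        simpa [Prod.dist_eq, dist_eq_norm] using
          hΛ.dist_le_mul _ (hbox t (hεsub ht) _ (hb t ht).2).1.2 _
          (hbox t (hεsub ht) _ (hc t ht).2).1.2) hzero hs'
    rw [hbc, hc0, sub_self, norm_zero, mul_zero, norm_le_zero_iff, sub_eq_zero, hb0] at this
    exact this
  · have := hgron c hc 0 hzero s (hrsub hs)
    rw [hc0, show ((0 : ℝ), (0 : ℝ)) = 0 from rfl, hg0, norm_zero, mul_zero] at this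
    rw [h]
    exact norm_le_zero_iff.1 this

/-! ### Straightening the zero set of a field in the plane -/

/-- The shear that straightens the graph of `c`, as a homeomorphism from a square onto its image. -/
def graphShear (r : ℝ) (c : ℝ → ℝ) (hc : ContinuousOn c (Ioo (-r) r)) :
    OpenPartialHomeomorph (ℝ × ℝ) (ℝ × ℝ) where
  toFun x := (x.1, x.2 - c x.1)
  invFun x := (x.1, x.2 + c x.1)
  source := Ioo (-r) r ×ˢ Ioo (-r) r
  target := (Ioo (-r) r ×ˢ univ) ∩ (fun x : ℝ × ℝ => x.2 + c x.1) ⁻¹' Ioo (-r) r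
  map_source' x hx := by simpa using hx
  map_target' x hx := by simpa using hx
  left_inv' x hx := by simp
  right_inv' x hx := by simp
  open_source := isOpen_Ioo.prod isOpen_Ioo
  open_target := by
    refine ContinuousOn.isOpen_inter_preimage ?_ (isOpen_Ioo.prod isOpen_univ) isOpen_Ioo
    exact continuousOn_snd.add (hc.comp continuousOn_fst fun x hx => hx.1)
  continuousOn_toFun := continuousOn_fst.prodMk
    (continuousOn_snd.sub (hc.comp continuousOn_fst fun x hx => hx.1))
  continuousOn_invFun := continuousOn_fst.prodMk
    (continuousOn_snd.add (hc.comp continuousOn_fst fun x hx => hx.1.1))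

/-- The two coordinates of the Euclidean plane. -/
noncomputable def euclideanPlaneEquivProd : EuclideanSpace ℝ (Fin 2) ≃L[ℝ] ℝ × ℝ :=
  (EuclideanSpace.equiv (Fin 2) ℝ).trans (ContinuousLinearEquiv.finTwoArrow ℝ ℝ)

lemma exists_continuousLinearEquiv_prod_fst_ne_zero {y : EuclideanSpace ℝ (Fin 2)} (hy : y ≠ 0) :
    ∃ A : EuclideanSpace ℝ (Fin 2) ≃L[ℝ] ℝ × ℝ, (A y).1 ≠ 0 := by
  by_cases h : y 0 = 0
  · refine ⟨euclideanPlaneEquivProd.trans (ContinuousLinearEquiv.prodComm ℝ ℝ ℝ), fun h' => hy ?_⟩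
    ext i
    fin_cases i
    · exact h
    · exact h'
  · exact ⟨euclideanPlaneEquivProd, h⟩

/-- If a field `Y` in the plane tracks `X` and `Y p ≠ 0`, where `p` is a non-flat zero of `X`,
then a smooth change of coordinates near `p` takes the zeros of `X` to the horizontal axis. -/
theorem exists_straightening_of_lieBracket_eq_smul
    {X Y : EuclideanSpace ℝ (Fin 2) → EuclideanSpace ℝ (Fin 2)}
    {f : EuclideanSpace ℝ (Fin 2) → ℝ} {Ω : Set (EuclideanSpace ℝ (Fin 2))}
    {p : EuclideanSpace ℝ (Fin 2)} (hΩ : IsOpen Ω) (hp : p ∈ Ω) (hX : ContDiffOn ℝ ∞ X Ω)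
    (hY : ContDiffOn ℝ ∞ Y Ω) (hf : ContinuousOn f Ω)
    (hXY : ∀ x ∈ Ω, VectorField.lieBracket ℝ Y X x = f x • X x)
    (hXp : X p = 0) (hflat : ¬ IsFlatAt X p) (hYp : Y p ≠ 0) :
    ∃ ψ : OpenPartialHomeomorph (EuclideanSpace ℝ (Fin 2)) (EuclideanSpace ℝ (Fin 2)),
      p ∈ ψ.source ∧ ContDiffOn ℝ ∞ ψ ψ.source ∧ ContDiffOn ℝ ∞ ψ.symm ψ.target ∧
        ∀ x ∈ ψ.source, X x = 0 ↔ ψ x 1 = 0 := by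
  obtain ⟨A, hA⟩ := exists_continuousLinearEquiv_prod_fst_ne_zero hYp
  have hcY : ContinuousAt Y p := (hY.continuousOn).continuousAt (hΩ.mem_nhds hp)
  have hcDY : ContinuousAt (fderiv ℝ Y) p :=
    ((hY.contDiffAt (hΩ.mem_nhds hp)).fderiv_right (m := 0) (by simp)).continuousAt
  have hcf : ContinuousAt f p := hf.continuousAt (hΩ.mem_nhds hp)
  have hcA : ContinuousAt (fun x => (A (Y x)).1) p :=
    continuousAt_fst.comp (A.continuous.continuousAt.comp hcY)
  -- Along the multiple of `Y` whose first component is `1`, the derivative of `X` is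
  -- `(DY X + f X) / Y₁`, and so it is bounded by a multiple of `X`.
  set b : EuclideanSpace ℝ (Fin 2) → ℝ := fun x => |((A (Y x)).1)⁻¹| * (‖fderiv ℝ Y x‖ + |f x|)
  have hcb : ContinuousAt b p := ((hcA.inv₀ hA).abs).mul (hcDY.norm.add hcf.abs)
  have hnear : ∀ᶠ x in 𝓝 p, x ∈ Ω ∧ (A (Y x)).1 ≠ 0 ∧ b x < b p + 1 :=
    (hΩ.eventually_mem hp).and ((hcA.eventually_ne hA).and
      (hcb.eventually_lt_const (by linarith)))
  obtain ⟨Ω', hΩ'sub, hΩ', hp'⟩ := _root_.mem_nhds_iff.1 hnear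
  set τ : ℝ × ℝ → EuclideanSpace ℝ (Fin 2) := fun z => A.symm z + p with hτ
  have hτs : ContDiff ℝ ∞ τ := A.symm.contDiff.add contDiff_const
  have hτ0 : τ 0 = p := by simp [hτ]
  have hmaps : MapsTo τ (τ ⁻¹' Ω') Ω := fun z hz => (hΩ'sub hz).1
  have hYτ : ContDiffOn ℝ ∞ (fun z => A (Y (τ z))) (τ ⁻¹' Ω') :=
    A.contDiff.comp_contDiffOn (hY.comp hτs.contDiffOn hmaps)
  obtain ⟨r, hr, c, hc, hzero⟩ := exists_smooth_graph_of_norm_fderiv_le (g := fun z => X (τ z))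
    (w := fun z => (A (Y (τ z))).2 / (A (Y (τ z))).1) (Ω := τ ⁻¹' Ω') (K := b p + 1)
    (hΩ'.preimage hτs.continuous) (by rwa [mem_preimage, hτ0]) (hX.comp hτs.contDiffOn hmaps)
    (hYτ.snd.div hYτ.fst fun z hz => (hΩ'sub hz).2.1) (fun z hz => by
      obtain ⟨hzΩ, hz1, hz2⟩ := hΩ'sub hz
      have hdX : DifferentiableAt ℝ X (τ z) :=
        (hX.contDiffAt (hΩ.mem_nhds hzΩ)).differentiableAt (by simp)
      have hd : HasFDerivAt (fun z => X (τ z))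
          ((fderiv ℝ X (τ z)).comp (A.symm : ℝ × ℝ →L[ℝ] EuclideanSpace ℝ (Fin 2))) z :=
        hdX.hasFDerivAt.comp z (A.symm.hasFDerivAt.add_const p)
      have hdir : A.symm (1, (A (Y (τ z))).2 / (A (Y (τ z))).1) =
          ((A (Y (τ z))).1)⁻¹ • Y (τ z) := by
        rw [ContinuousLinearEquiv.symm_apply_eq, map_smul]
        ext
        · simp [hz1]
        · simp [div_eq_inv_mul]
      have hbr := hXY _ hzΩ
      rw [VectorField.lieBracket, sub_eq_iff_eq_add] at hbr
      rw [hd.fderiv, ContinuousLinearMap.comp_apply, ContinuousLinearEquiv.coe_coe, hdir,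
        map_smul, hbr, norm_smul]
      calc ‖((A (Y (τ z))).1)⁻¹‖ * ‖f (τ z) • X (τ z) + fderiv ℝ Y (τ z) (X (τ z))‖
          ≤ ‖((A (Y (τ z))).1)⁻¹‖ * (|f (τ z)| * ‖X (τ z)‖ + ‖fderiv ℝ Y (τ z)‖ * ‖X (τ z)‖) := by
            gcongr
            refine (norm_add_le _ _).trans (add_le_add (by rw [norm_smul, Real.norm_eq_abs]) ?_)
            exact ContinuousLinearMap.le_opNorm _ _
        _ = b (τ z) * ‖X (τ z)‖ := by simp only [b, Real.norm_eq_abs]; ring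
        _ ≤ (b p + 1) * ‖X (τ z)‖ := by gcongr)
    (by simpa [hτ0] using hXp) (fun hg => hflat fun k => by
      have hlim : Tendsto (fun x => A (x - p)) (𝓝 p) (𝓝 0) := by
        have : Continuous fun x => A (x - p) := by fun_prop
        simpa using this.tendsto p
      have h1 := (hg k).comp_tendsto hlim
      have h2 : (fun x => ‖A (x - p) - 0‖) =O[𝓝 p] fun x => ‖x - p‖ := by
        simpa using ((A : EuclideanSpace ℝ (Fin 2) →L[ℝ] ℝ × ℝ).isBigO_comp
          (fun x => x - p) (𝓝 p)).norm_norm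
      have h3 := h1.trans (h2.pow k)
      simpa [Function.comp_def, hτ] using h3)
  set S := graphShear r c hc.continuousOn
  have hSs : ContDiffOn ℝ ∞ S S.source :=
    contDiff_fst.contDiffOn.prodMk (contDiff_snd.contDiffOn.sub
      (hc.comp contDiff_fst.contDiffOn fun x hx => hx.1))
  have hSt : ContDiffOn ℝ ∞ S.symm S.target :=
    contDiff_fst.contDiffOn.prodMk (contDiff_snd.contDiffOn.add
      (hc.comp contDiff_fst.contDiffOn fun x hx => hx.1.1))
  let h := (Homeomorph.subRight p).trans A.toHomeomorph
  have hh : ContDiff ℝ ∞ h := A.contDiff.comp (contDiff_id.sub contDiff_const)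
  have hhs : ContDiff ℝ ∞ h.symm := hτs
  refine ⟨(h.transOpenPartialHomeomorph S).transHomeomorph
    euclideanPlaneEquivProd.symm.toHomeomorph, ?_, ?_, ?_, ?_⟩
  · change A (p - p) ∈ S.source
    rw [sub_self, map_zero]
    exact ⟨by simpa using hr, by simpa using hr⟩
  · exact euclideanPlaneEquivProd.symm.contDiff.comp_contDiffOn
      (hSs.comp hh.contDiffOn fun x hx => hx)
  · exact hhs.comp_contDiffOn
      (hSt.comp euclideanPlaneEquivProd.contDiff.contDiffOn fun x hx => hx)
  · intro x hx
    have hx' : A (x - p) ∈ Ioo (-r) r ×ˢ Ioo (-r) r := hx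
    have := hzero _ hx'.1 _ hx'.2
    have hback : τ (A (x - p)) = x := by simp [hτ]
    rw [Prod.mk.eta, hback] at this
    rw [this, ← sub_eq_zero]
    rfl

/-! ### Passage to coordinates on the manifold -/

section Coordinates

open Tracking VectorField

variable {n : ℕ} {M : Type*} [TopologicalSpace M] [ChartedSpace (EuclideanSpace ℝ (Fin n)) M]
  [IsManifold (𝓡 n) ∞ M] {X Y : (q : M) → TangentSpace (𝓡 n) q} {U : Set M} {p : M}
  {x : EuclideanSpace ℝ (Fin n)}

omit [IsManifold (𝓡 n) ∞ M] in
lemma isOpen_extChartAt_target_inter_preimage (hU : IsOpen U) (p : M) :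
    IsOpen ((extChartAt (𝓡 n) p).target ∩ (extChartAt (𝓡 n) p).symm ⁻¹' U) :=
  (continuousOn_extChartAt_symm p).isOpen_inter_preimage (isOpen_extChartAt_target p) hU

lemma isInvertible_mfderiv_extChartAt_symm_of_mem_target
    (hx : x ∈ (extChartAt (𝓡 n) p).target) :
    (mfderiv 𝓘(ℝ, EuclideanSpace ℝ (Fin n)) (𝓡 n)
      (extChartAt (𝓡 n) p).symm x).IsInvertible := by
  have : IsManifold (𝓡 n) 1 M := IsManifold.of_le (n := ∞) (by simp)
  have := isInvertible_mfderivWithin_extChartAt_symm hx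
  rwa [ModelWithCorners.range_eq_univ, mfderivWithin_univ] at this

lemma contMDiffAt_extChartAt_symm_of_mem_target (hx : x ∈ (extChartAt (𝓡 n) p).target) :
    ContMDiffAt 𝓘(ℝ, EuclideanSpace ℝ (Fin n)) (𝓡 n) ∞ (extChartAt (𝓡 n) p).symm x :=
  (contMDiffOn_extChartAt_symm p).contMDiffAt ((isOpen_extChartAt_target p).mem_nhds hx)

omit [IsManifold (𝓡 n) ∞ M] in
lemma inCoordinates_eq_mpullback (X : (q : M) → TangentSpace (𝓡 n) q) (p : M) :
    inCoordinates X p = mpullback 𝓘(ℝ, EuclideanSpace ℝ (Fin n)) (𝓡 n)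
      (extChartAt (𝓡 n) p).symm X := by
  rw [inCoordinates, ModelWithCorners.range_eq_univ, mpullbackWithin_univ]

lemma inCoordinates_eq_zero_iff (hx : x ∈ (extChartAt (𝓡 n) p).target) :
    inCoordinates X p x = 0 ↔ X ((extChartAt (𝓡 n) p).symm x) = 0 := by
  rw [inCoordinates_eq_mpullback, mpullback_apply]
  obtain ⟨e, he⟩ := isInvertible_mfderiv_extChartAt_symm_of_mem_target hx
  rw [← he, ContinuousLinearMap.inverse_equiv]
  exact e.symm.map_eq_zero_iff

lemma contDiffOn_inCoordinates (hU : IsOpen U) (hX : IsSmoothFieldOn X U) :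
    ContDiffOn ℝ ∞ (inCoordinates X p)
      ((extChartAt (𝓡 n) p).target ∩ (extChartAt (𝓡 n) p).symm ⁻¹' U) := by
  intro x hx
  refine ContDiffAt.contDiffWithinAt ?_
  rw [inCoordinates_eq_mpullback, ← contMDiffAt_vectorSpace_iff_contDiffAt]
  exact ContMDiffAt.mpullback_vectorField_preimage (n := ∞)
    ((hX _ hx.2).contMDiffAt (hU.mem_nhds hx.2))
    (contMDiffAt_extChartAt_symm_of_mem_target hx.1)
    (isInvertible_mfderiv_extChartAt_symm_of_mem_target hx.1) (by simp)

/-- Passing to coordinates commutes with the Lie bracket. Mathlib defines the bracket at a point in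
the preferred chart about that point, so that this concerns a change of charts. -/
lemma lieBracket_inCoordinates (hU : IsOpen U) (hX : IsSmoothFieldOn X U)
    (hY : IsSmoothFieldOn Y U)
    (hx : x ∈ (extChartAt (𝓡 n) p).target ∩ (extChartAt (𝓡 n) p).symm ⁻¹' U) :
    lieBracket ℝ (inCoordinates Y p) (inCoordinates X p) x =
      inCoordinates (mlieBracket (𝓡 n) Y X) p x := by
  have : IsManifold (𝓡 n) (minSmoothness ℝ 2) M := by
    rw [minSmoothness_of_isRCLikeNormedField]
    exact IsManifold.of_le (n := ∞) (by norm_cast)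
  have hd : ∀ {Z : (q : M) → TangentSpace (𝓡 n) q}, IsSmoothFieldOn Z U →
      MDifferentiableAt (𝓡 n) (𝓡 n).tangent
        (fun q : M => (⟨q, Z q⟩ : TangentBundle (𝓡 n) M)) ((extChartAt (𝓡 n) p).symm x) :=
    fun hZ => ((hZ _ hx.2).contMDiffAt (hU.mem_nhds hx.2)).mdifferentiableAt (by simp)
  have := mpullback_mlieBracket (n := ∞) (hd hY) (hd hX)
    (contMDiffAt_extChartAt_symm_of_mem_target hx.1)
    (by rw [minSmoothness_of_isRCLikeNormedField]; norm_cast)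
  rw [inCoordinates_eq_mpullback (mlieBracket (𝓡 n) Y X), this, inCoordinates_eq_mpullback,
    inCoordinates_eq_mpullback, ← mlieBracketWithin_univ, mlieBracketWithin_eq_lieBracketWithin]
  exact (congrFun lieBracketWithin_univ x).symm

lemma not_isFlatAt_inCoordinates (hX : IsSmoothFieldOn X univ) (hp : order X p ≠ ⊤) :
    ¬ IsFlatAt (inCoordinates X p) (extChartAt (𝓡 n) p p) := by
  intro h
  have hsmooth := (contDiffOn_inCoordinates (p := p) isOpen_univ hX).contDiffAt
    ((isOpen_extChartAt_target_inter_preimage isOpen_univ p).mem_nhds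
      ⟨mem_extChartAt_target p, mem_univ _⟩)
  refine hp ?_
  have : {k : ℕ∞ | ∃ m : ℕ, k = m ∧
      iteratedFDeriv ℝ m (inCoordinates X p) (extChartAt (𝓡 n) p p) ≠ 0} = ∅ :=
    eq_empty_of_forall_notMem fun k ⟨m, _, hm⟩ => hm (isFlatAt_iteratedFDeriv h hsmooth m).eq_zero
  rw [order, this, sInf_empty]

lemma trans_mem_maximalAtlas
    {ψ : OpenPartialHomeomorph (EuclideanSpace ℝ (Fin n)) (EuclideanSpace ℝ (Fin n))}
    {e : OpenPartialHomeomorph M (EuclideanSpace ℝ (Fin n))}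
    (he : e ∈ IsManifold.maximalAtlas (𝓡 n) ∞ M)
    (hψ : ContDiffOn ℝ ∞ ψ ψ.source) (hψ' : ContDiffOn ℝ ∞ ψ.symm ψ.target) :
    e.trans ψ ∈ IsManifold.maximalAtlas (𝓡 n) ∞ M := by
  apply OpenPartialHomeomorph.mem_maximalAtlas_of_contMDiffOn
  · exact hψ.contMDiffOn.comp
      ((contMDiffOn_of_mem_maximalAtlas he).mono fun q hq => hq.1) fun q hq => hq.2
  · exact (contMDiffOn_symm_of_mem_maximalAtlas he).comp
      (hψ'.contMDiffOn.mono fun q hq => hq.1) fun q hq => hq.2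

end Coordinates

theorem proposition2 {M : Type*} [TopologicalSpace M] [T2Space M]
    [ChartedSpace (EuclideanSpace ℝ (Fin 2)) M] [IsManifold (𝓡 2) ∞ M]
    (X : (q : M) → TangentSpace (𝓡 2) q) (hX : Tracking.IsSmoothFieldOn X Set.univ)
    (hne : (Tracking.zeros X).Nonempty) (hflat : Tracking.zerosOfOrder X ⊤ = ∅) :
    Tracking.IsRegularSubmanifold 2 1 (Tracking.zeros X) ∨
      ∃ p : M, Tracking.IsPrimarySingularity X p := by
  refine or_iff_not_imp_right.2 fun hprim => ⟨one_le_two, fun p hp => ?_⟩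
  obtain ⟨U, Y, hU, hpU, hY, ⟨f, hf, hYX⟩, hYp⟩ : ∃ (U : Set M)
      (Y : (q : M) → TangentSpace (𝓡 2) q), IsOpen U ∧ p ∈ U ∧ Tracking.IsSmoothFieldOn Y U ∧
        Tracking.TracksOn Y X U ∧ Y p ≠ 0 := by
    by_contra! h
    exact hprim ⟨p, hp, h⟩
  have horder : Tracking.order X p ≠ ⊤ := fun h =>
    (hflat ▸ (⟨hp, h⟩ : p ∈ Tracking.zerosOfOrder X ⊤) : p ∈ (∅ : Set M))
  have hpt : extChartAt (𝓡 2) p p ∈ (extChartAt (𝓡 2) p).target := mem_extChartAt_target p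
  have hsymm : (extChartAt (𝓡 2) p).symm (extChartAt (𝓡 2) p p) = p := extChartAt_to_inv p
  have hXU : Tracking.IsSmoothFieldOn X U := hX.mono (subset_univ U)
  obtain ⟨ψ, hpψ, hψ, hψ', hzero⟩ := exists_straightening_of_lieBracket_eq_smul
    (isOpen_extChartAt_target_inter_preimage hU p)
    (p := extChartAt (𝓡 2) p p) ⟨hpt, by rwa [mem_preimage, hsymm]⟩
    (contDiffOn_inCoordinates hU hXU) (contDiffOn_inCoordinates hU hY)
    (f := f ∘ (extChartAt (𝓡 2) p).symm)
    (hf.comp ((continuousOn_extChartAt_symm p).mono inter_subset_left) fun x hx => hx.2)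
    (fun x hx => by
      rw [lieBracket_inCoordinates hU hXU hY hx, inCoordinates_eq_mpullback,
        inCoordinates_eq_mpullback, VectorField.mpullback_apply, VectorField.mpullback_apply,
        hYX _ hx.2]
      exact map_smul _ _ _)
    ((inCoordinates_eq_zero_iff hpt).2 (by rw [hsymm]; exact hp))
    (not_isFlatAt_inCoordinates hX horder)
    ((inCoordinates_eq_zero_iff hpt).not.2 (by rwa [hsymm]))
  refine ⟨(chartAt _ p).trans ψ, trans_mem_maximalAtlas
    (IsManifold.chart_mem_maximalAtlas p) hψ hψ', ?_, fun q hq => ?_⟩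
  · rw [OpenPartialHomeomorph.trans_source]
    exact ⟨mem_chart_source _ p, hpψ⟩
  · rw [OpenPartialHomeomorph.trans_source] at hq
    have hq1 : q ∈ (extChartAt (𝓡 2) p).source := by
      rw [extChartAt_source]; exact hq.1
    have hiff : q ∈ Tracking.zeros X ↔ ψ (chartAt _ p q) 1 = 0 := by
      rw [← hzero _ hq.2]
      have := inCoordinates_eq_zero_iff (X := X) ((extChartAt (𝓡 2) p).map_source hq1)
      rw [(extChartAt (𝓡 2) p).left_inv hq1] at this
      exact this.symm
    rw [hiff]
    refine ⟨fun h i hi => ?_, fun h => h 1 le_rfl⟩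
    obtain rfl : i = 1 := by fin_cases i <;> simp_all
    exact h
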